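/- Let $m,n,q,s$ be nonnegative integers, $M\in\mathbb R^{m\times n}$ a fixed matrix, $\mu\in\mathbb R$ and $\sigma>0$. Let $G$ be a random $q\times m$ matrix and $H$ a random $n\times s$ matrix, each filled with independent Gaussian entries having mean $\mu$ and variance $\sigma^2$. Let $\|\cdot\|$ denote the spectral norm, $A^+$ the Moore–Penrose pseudo-inverse of a matrix $A$, $A_j^{(j)}$ the leading (northwestern) $j\times j$ block of $A$, $M_j$ the $m\times j$ matrix formed by the first $j$ columns of $M$, and $M^{(k)}$ the $k\times n$ matrix formed by the first $k$ rows of $M$. For a real random variable $\gamma$ write $F_\gamma(y)=\mathrm{Probability}\{\gamma\le y\}$; put $1/\|A^+\|=0$ if $A=0$. Then the following holds. (i) If $\operatorname{rank}(M)\ge q$, then with probability $1$ the matrix $GM$ has full rank, i.e. $\operatorname{rank}(GM)=\min\{q,n\}$. If $\operatorname{rank}(M)\ge s$, then with probability $1$ the matrix $MH$ has full rank, i.e. $\operatorname{rank}(MH)=\min\{m,s\}$. (ii) For every $j$ with $1\le j\le\min\{q,n\}$ and $\operatorname{rank}(M_j)=j$ and every $y\ge0$, $$F_{1/\|((GM)_j^{(j)})^+\|}(y)\le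 \frac{2.35\,y\sqrt j\,\|M_j^+\|}{\sigma},$$ and for every $x>0$, $$\mathrm{Probability}\Big\{\|((GM)_j^{(j)})^+\|\ge \frac{2.35\,x\sqrt j\,\|M_j^+\|}{\sigma}\Big\}\le\frac1x .$$ For every $k$ with $1\le k\le\min\{m,s\}$ and $\operatorname{rank}(M^{(k)})=k$ and every $y\ge0$, $$F_{1/\|((MH)_k^{(k)})^+\|}(y)\le \frac{2.35\,y\sqrt k\,\|(M^{(k)})^+\|}{\sigma},$$ and for every $x>0$, $$\mathrm{Probability}\Big\{\|((MH)_k^{(k)})^+\|\ge \frac{2.35\,x\sqrt k\,\|(M^{(k)})^+\|}{\sigma}\Big\}\le\frac1x .$$ -/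

import Mathlib

open MeasureTheory ProbabilityTheory
open scoped Matrix Matrix.Norms.L2Operator

/-- `G` is a Gaussian random `m × n` matrix with mean `μ` and variance `σ ^ 2` on `(Ω, P)`:
its entries are independent and each of them has the law `N(μ, σ²)`. -/
structure IsGaussianMatrix {Ω : Type*} [MeasurableSpace Ω] {m n : ℕ}
    (G : Ω → Matrix (Fin m) (Fin n) ℝ) (μ σ : ℝ) (P : Measure Ω) : Prop where
  hasLaw : ∀ i j, HasLaw (fun ω => G ω i j) (gaussianReal μ (Real.toNNReal (σ ^ 2))) P
  indep : iIndepFun (fun (p : Fin m × Fin n) (ω : Ω) => G ω p.1 p.2) P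

/-- The four Penrose equations, which say that `B` is the Moore–Penrose pseudo-inverse of `A`. -/
structure IsMoorePenrose {m n : ℕ} (A : Matrix (Fin m) (Fin n) ℝ)
    (B : Matrix (Fin n) (Fin m) ℝ) : Prop where
  mul_mul_left : A * B * A = A
  mul_mul_right : B * A * B = B
  symm_left : (A * B)ᵀ = A * B
  symm_right : (B * A)ᵀ = B * A

theorem IsMoorePenrose.unique {m n : ℕ} {A : Matrix (Fin m) (Fin n) ℝ}
    {B C : Matrix (Fin n) (Fin m) ℝ} (hB : IsMoorePenrose A B) (hC : IsMoorePenrose A C) :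
    B = C := by
  have h1 : A * B = A * C := by
    calc A * B = (A * C) * (A * B) := by
          rw [← Matrix.mul_assoc, hC.mul_mul_left]
      _ = (A * C)ᵀ * (A * B)ᵀ := by rw [hC.symm_left, hB.symm_left]
      _ = ((A * B) * (A * C))ᵀ := by rw [Matrix.transpose_mul (A * B)]
      _ = (A * C)ᵀ := by rw [← Matrix.mul_assoc, hB.mul_mul_left]
      _ = A * C := hC.symm_left
  have h2 : B * A = C * A := by
    calc B * A = (B * A) * (C * A) := by
          rw [Matrix.mul_assoc, ← Matrix.mul_assoc A, hC.mul_mul_left]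
      _ = (B * A)ᵀ * (C * A)ᵀ := by rw [hC.symm_right, hB.symm_right]
      _ = ((C * A) * (B * A))ᵀ := by rw [Matrix.transpose_mul (C * A)]
      _ = (C * A)ᵀ := by rw [Matrix.mul_assoc, ← Matrix.mul_assoc A, hB.mul_mul_left]
      _ = C * A := hC.symm_right
  calc B = B * A * B := hB.mul_mul_right.symm
    _ = C * A * C := by rw [h2, Matrix.mul_assoc, h1, ← Matrix.mul_assoc]
    _ = C := hC.mul_mul_right

theorem exists_isMoorePenrose {m n : ℕ} (A : Matrix (Fin m) (Fin n) ℝ) :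
    ∃ B, IsMoorePenrose A B := by
  have hS : (Aᵀ * A).IsHermitian := by
    have := Matrix.isHermitian_conjTranspose_mul_self A
    rwa [Matrix.conjTranspose_eq_transpose_of_trivial] at this
  -- a symmetric pseudo-inverse of `Aᵀ * A`
  obtain ⟨R, hRt, h1, h2, h3⟩ : ∃ R : Matrix (Fin n) (Fin n) ℝ, Rᵀ = R ∧
      (Aᵀ * A) * R * (Aᵀ * A) = Aᵀ * A ∧ R * (Aᵀ * A) * R = R ∧
      (R * (Aᵀ * A))ᵀ = R * (Aᵀ * A) := by
    set S := Aᵀ * A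
    let U : Matrix (Fin n) (Fin n) ℝ := (hS.eigenvectorUnitary : Matrix (Fin n) (Fin n) ℝ)
    let d := hS.eigenvalues
    have hU : Uᵀ * U = 1 := by
      have := Unitary.coe_star_mul_self hS.eigenvectorUnitary
      rwa [Matrix.star_eq_conjTranspose, Matrix.conjTranspose_eq_transpose_of_trivial] at this
    have hSd : S = U * Matrix.diagonal d * Uᵀ := by
      have := hS.spectral_theorem
      simpa [Unitary.conjStarAlgAut_apply, Matrix.star_eq_conjTranspose,
        Matrix.conjTranspose_eq_transpose_of_trivial, U, d, Function.comp_def] using this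
    have key : ∀ a b : Fin n → ℝ, (U * Matrix.diagonal a * Uᵀ) * (U * Matrix.diagonal b * Uᵀ)
        = U * Matrix.diagonal (fun i => a i * b i) * Uᵀ := by
      intro a b
      calc _ = U * Matrix.diagonal a * (Uᵀ * U) * Matrix.diagonal b * Uᵀ := by
            simp only [Matrix.mul_assoc]
        _ = _ := by
            rw [hU, Matrix.mul_one, Matrix.mul_assoc U, Matrix.diagonal_mul_diagonal]
    have keyT : ∀ a : Fin n → ℝ, (U * Matrix.diagonal a * Uᵀ)ᵀ = U * Matrix.diagonal a * Uᵀ := by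
      intro a
      simp [Matrix.transpose_mul, Matrix.mul_assoc]
    refine ⟨U * Matrix.diagonal (fun i => (d i)⁻¹) * Uᵀ, keyT _, ?_, ?_, ?_⟩
    · rw [hSd, key, key]
      simp only [mul_inv_mul_cancel]
    · rw [hSd, key, key]
      have hd : (fun i => (d i)⁻¹ * d i * (d i)⁻¹) = fun i => (d i)⁻¹ := by
        funext i
        simpa using mul_inv_mul_cancel (d i)⁻¹
      rw [hd]
    · rw [hSd, key, keyT]
  have hA : A * (R * (Aᵀ * A)) = A := by
    have h0 : Aᵀ * A * (R * (Aᵀ * A) - 1) = 0 := by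
      rw [Matrix.mul_sub, Matrix.mul_one, ← Matrix.mul_assoc, h1, sub_self]
    have h0' : A * (R * (Aᵀ * A) - 1) = 0 := by
      have := (Matrix.conjTranspose_mul_self_mul_eq_zero A (R * (Aᵀ * A) - 1)).1
      rw [Matrix.conjTranspose_eq_transpose_of_trivial] at this
      exact this h0
    rw [Matrix.mul_sub, Matrix.mul_one, sub_eq_zero] at h0'
    exact h0'
  refine ⟨R * Aᵀ, ?_, ?_, ?_, ?_⟩
  · simpa only [Matrix.mul_assoc] using hA
  · calc R * Aᵀ * A * (R * Aᵀ) = (R * (Aᵀ * A) * R) * Aᵀ := by simp only [Matrix.mul_assoc]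
      _ = R * Aᵀ := by rw [h2]
  · simp only [Matrix.transpose_mul, Matrix.transpose_transpose, hRt, Matrix.mul_assoc]
  · simpa only [Matrix.mul_assoc] using h3

/-- The Moore–Penrose pseudo-inverse `A⁺`. -/
noncomputable def pinv {m n : ℕ} (A : Matrix (Fin m) (Fin n) ℝ) : Matrix (Fin n) (Fin m) ℝ :=
  Classical.choose (exists_isMoorePenrose A)

theorem pinv_isMoorePenrose {m n : ℕ} (A : Matrix (Fin m) (Fin n) ℝ) :
    IsMoorePenrose A (pinv A) :=
  Classical.choose_spec (exists_isMoorePenrose A)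

/-- The block of the first `j` columns of `M`. -/
def leadingCols {m n : ℕ} (M : Matrix (Fin m) (Fin n) ℝ) (j : ℕ) (hj : j ≤ n) :
    Matrix (Fin m) (Fin j) ℝ :=
  M.submatrix id (Fin.castLE hj)

/-- The block of the first `k` rows of `M`. -/
def leadingRows {m n : ℕ} (M : Matrix (Fin m) (Fin n) ℝ) (k : ℕ) (hk : k ≤ m) :
    Matrix (Fin k) (Fin n) ℝ :=
  M.submatrix (Fin.castLE hk) id

/-- The leading (northwestern) `k × k` block of `A`. -/
def leadingBlock {m n : ℕ} (A : Matrix (Fin m) (Fin n) ℝ) (k : ℕ) (hm : k ≤ m) (hn : k ≤ n) :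
    Matrix (Fin k) (Fin k) ℝ :=
  A.submatrix (Fin.castLE hm) (Fin.castLE hn)

/-- The cumulative distribution function `F_X(y) = P{X ≤ y}` of a random variable `X`. -/
noncomputable def cdfOf {Ω : Type*} [MeasurableSpace Ω] (P : Measure Ω) (X : Ω → ℝ) (y : ℝ) : ℝ :=
  P.real {ω | X ω ≤ y}

/-! ### Linear images of i.i.d. Gaussian vectors, and numerical Gaussian estimates. -/

section Gaussian

variable {Ω : Type*} [MeasurableSpace Ω] {P : Measure Ω} {ι κ κ' : Type*} [Fintype ι]
  {X : ι → Ω → ℝ} {μ : ℝ} {v : NNReal}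

/-! Since the leading block of `G * M` is (leading rows of `G`) times (leading columns of `M`), part
(ii) concerns the square matrix `A = G * N`, where `N` has full column rank and left inverse `L =
pinv N`. The case of `M * H` follows by transposition.

Almost sure invertibility: moving `G` along `L` moves `A` along the identity, because `L * N = 1`.
Given the other components of `G`, `det A` is, up to scaling, a characteristic polynomial at an
atomless Gaussian point. For part (i), `M` is replaced by some `M * W` with `q` independent columns.

Norm bound (the Sankar–Spielman–Teng argument): fix `v = ‖v‖ e` and split `G = B + e aᵀ` with `a =
eᵀ G`. Then `B` and `a` are independent and `eᵀ B = 0`, so `B N t = 0` for some `t ≠ 0`. With `w = N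
t` this gives `A t = (a·w) e`, hence `A⁻¹ v = (‖v‖ / (a·w)) t`. It is large only if the Gaussian
`a·w`, of standard deviation `σ‖w‖ ≥ σ‖t‖ / ‖L‖`, is small; bounding its density works for every
mean. Finally `v` is averaged over a standard Gaussian: `‖A⁻¹ v‖ ≥ ‖A⁻¹‖ |⟨u, v⟩|` for a unit vector
`u`, and `E‖v‖ ≤ √j`, which yields the factor `√j` and the constant 2.35. -/

theorem covariance_linComb_of_iIndepFun [IsProbabilityMeasure P]
    (hX : ∀ i, HasLaw (X i) (gaussianReal μ v) P) (hI : iIndepFun X P) (c d : ι → ℝ) :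
    cov[fun ω => ∑ i, c i * X i ω, fun ω => ∑ i, d i * X i ω; P] = v * ∑ i, c i * d i := by
  classical
  have hL : ∀ i, MemLp (X i) 2 P := fun i => (hX i).hasGaussianLaw.memLp_two
  have hcov : ∀ i j, cov[X i, X j; P] = if i = j then (v : ℝ) else 0 := by
    intro i j
    split_ifs with h
    · subst h
      rw [covariance_self (hL i).aemeasurable, (hX i).variance_eq, variance_id_gaussianReal]
    · exact (hI.indepFun h).covariance_eq_zero (hL i) (hL j)
  rw [covariance_fun_sum_fun_sum (fun i => (hL i).const_mul _) (fun i => (hL i).const_mul _)]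
  simp only [covariance_const_mul_left, covariance_const_mul_right, hcov, mul_ite, mul_zero,
    Finset.sum_ite_eq, Finset.mem_univ, if_true, Finset.mul_sum]
  exact Finset.sum_congr rfl fun i _ => by ring

theorem hasGaussianLaw_mulVec [Finite κ]
    (hX : ∀ i, HasLaw (X i) (gaussianReal μ v) P) (hI : iIndepFun X P) (c : Matrix κ ι ℝ) :
    HasGaussianLaw (fun ω => c *ᵥ fun i => X i ω) P := by
  have := Fintype.ofFinite κ
  exact (hI.hasGaussianLaw fun i => (hX i).hasGaussianLaw).map_fun
    (LinearMap.toContinuousLinearMap c.mulVecLin)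

/-- Jointly Gaussian vectors are independent once uncorrelated, and the cross-covariance here is `v
• (c * dᵀ)`, whatever the mean. -/
theorem indepFun_mulVec_of_mul_transpose_eq_zero [IsProbabilityMeasure P] [Finite κ] [Finite κ']
    (hX : ∀ i, HasLaw (X i) (gaussianReal μ v) P) (hI : iIndepFun X P)
    (c : Matrix κ ι ℝ) (d : Matrix κ' ι ℝ) (hcd : c * dᵀ = 0) :
    IndepFun (fun ω => c *ᵥ fun i => X i ω) (fun ω => d *ᵥ fun i => X i ω) P := by
  have := Fintype.ofFinite κ
  have := Fintype.ofFinite κ'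
  refine HasGaussianLaw.indepFun_of_covariance_eval
    (X := fun k ω => (c *ᵥ fun i => X i ω) k) (Y := fun k ω => (d *ᵥ fun i => X i ω) k) ?_ ?_
  · exact (hI.hasGaussianLaw fun i => (hX i).hasGaussianLaw).map_fun
      ((LinearMap.toContinuousLinearMap c.mulVecLin).prod
        (LinearMap.toContinuousLinearMap d.mulVecLin))
  · intro k l
    have h := congrFun (congrFun hcd k) l
    simp only [Matrix.mul_apply, Matrix.transpose_apply, Matrix.zero_apply] at h
    simpa [h, Matrix.mulVec, dotProduct] using covariance_linComb_of_iIndepFun hX hI (c k) (d l)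

/-- The component of a vector with i.i.d. Gaussian entries in a subspace and the component in its
orthogonal complement are independent. -/
theorem indepFun_orthogonal_components [IsProbabilityMeasure P] [Fintype κ] [DecidableEq κ]
    (hX : ∀ i, HasLaw (X i) (gaussianReal μ v) P) (hI : iIndepFun X P)
    (u : Matrix κ ι ℝ) (hu : u * uᵀ = 1) :
    IndepFun (fun ω => (fun i => X i ω) - uᵀ *ᵥ (u *ᵥ fun i => X i ω))
      (fun ω => u *ᵥ fun i => X i ω) P := by
  classical
  have h := indepFun_mulVec_of_mul_transpose_eq_zero hX hI u (1 - uᵀ * u) (by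
    rw [Matrix.transpose_sub, Matrix.transpose_mul, Matrix.transpose_transpose,
      Matrix.transpose_one, Matrix.mul_sub, ← Matrix.mul_assoc, hu]
    simp)
  convert! h.symm using 2 with ω
  rw [Matrix.sub_mulVec, Matrix.one_mulVec, Matrix.mulVec_mulVec]

/-- A bound on the sections of a set bounds the probability that the component of a vector with
i.i.d. Gaussian entries in a subspace and the orthogonal component lie in the set. -/
theorem measure_orthogonal_components_le [IsProbabilityMeasure P] [Fintype κ] [DecidableEq κ]
    (hX : ∀ i, HasLaw (X i) (gaussianReal μ v) P) (hI : iIndepFun X P)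
    (u : Matrix κ ι ℝ) (hu : u * uᵀ = 1) {S : Set ((ι → ℝ) × (κ → ℝ))} (hS : MeasurableSet S)
    {C : ENNReal} (hC : ∀ b, P {ω | (b, u *ᵥ fun i => X i ω) ∈ S} ≤ C) :
    P {ω | ((fun i => X i ω) - uᵀ *ᵥ (u *ᵥ fun i => X i ω), u *ᵥ fun i => X i ω) ∈ S} ≤ C := by
  have ha := (hasGaussianLaw_mulVec hX hI u).aemeasurable
  have hb := ((hI.hasGaussianLaw fun i => (hX i).hasGaussianLaw).map_fun
    (ContinuousLinearMap.id ℝ _ -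
      LinearMap.toContinuousLinearMap (uᵀ.mulVecLin ∘ₗ u.mulVecLin))).aemeasurable
  have hind := indepFun_orthogonal_components hX hI u hu
  set a := fun ω => u *ᵥ fun i => X i ω
  set b := fun ω => (fun i => X i ω) - uᵀ *ᵥ (u *ᵥ fun i => X i ω)
  have hb : AEMeasurable b P := hb
  have : IsProbabilityMeasure (P.map b) := Measure.isProbabilityMeasure_map hb
  calc P {ω | (b ω, a ω) ∈ S} = ((P.map b).prod (P.map a)) S := by
        rw [← (indepFun_iff_map_prod_eq_prod_map_map hb ha).1 hind,
          Measure.map_apply_of_aemeasurable (hb.prodMk ha) hS]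
        rfl
    _ ≤ ∫⁻ _, C ∂(P.map b) := by
        rw [Measure.prod_apply hS]
        refine lintegral_mono fun y => ?_
        rw [Measure.map_apply_of_aemeasurable ha (measurable_prodMk_left hS)]
        exact hC y
    _ = C := by simp

theorem hasLaw_linComb_gaussianReal [IsProbabilityMeasure P]
    (hX : ∀ i, HasLaw (X i) (gaussianReal μ v) P) (hI : iIndepFun X P) (c : ι → ℝ) :
    ∃ m : ℝ, HasLaw (fun ω => ∑ i, c i * X i ω)
      (gaussianReal m (v * Real.toNNReal (∑ i, c i ^ 2))) P := by
  have hG : HasGaussianLaw (fun ω => ∑ i, c i * X i ω) P := by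
    simpa [Matrix.mulVec, dotProduct] using
      (hasGaussianLaw_mulVec hX hI (Matrix.of fun _ : Unit => c)).eval ()
  refine ⟨∫ ω, ∑ i, c i * X i ω ∂P, hG.aemeasurable, ?_⟩
  rw [hG.map_eq_gaussianReal, ← covariance_self hG.aemeasurable,
    covariance_linComb_of_iIndepFun hX hI]
  congr 1
  rw [Real.toNNReal_mul v.coe_nonneg, Real.toNNReal_coe]
  simp only [pow_two]

theorem sqrt_two_div_pi : √(2 / Real.pi) = 2 / √(2 * Real.pi) := by
  rw [eq_div_iff (by positivity), ← Real.sqrt_mul (by positivity),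
    show 2 / Real.pi * (2 * Real.pi) = 2 ^ 2 by field_simp, Real.sqrt_sq (by norm_num)]

/-- Interval length `2ε` times the maximum of the density. Uniformity in `m` is what removes `μ`
from the final bounds. -/
theorem gaussianReal_abs_le {m : ℝ} {w : NNReal} (hw : w ≠ 0) (ε : ℝ) :
    gaussianReal m w {x | |x| ≤ ε} ≤ ENNReal.ofReal (√(2 / Real.pi) * ε / √w) := by
  have hset : {x : ℝ | |x| ≤ ε} = Set.Icc (-ε) ε := by ext x; simp [abs_le]
  have hw' : (0 : ℝ) < w := by positivity
  rw [gaussianReal_apply _ hw]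
  calc ∫⁻ x in {x | |x| ≤ ε}, gaussianPDF m w x
      ≤ ∫⁻ _ in {x : ℝ | |x| ≤ ε}, ENNReal.ofReal (√(2 * Real.pi * w))⁻¹ := by
        refine lintegral_mono fun x => ENNReal.ofReal_le_ofReal ?_
        rw [gaussianPDFReal_def]
        refine mul_le_of_le_one_right (by positivity) (Real.exp_le_one_iff.2 ?_)
        rw [neg_div]
        exact neg_nonpos.2 (by positivity)
    _ = ENNReal.ofReal (√(2 / Real.pi) * ε / √w) := by
        rw [setLIntegral_const, hset, Real.volume_Icc, ← ENNReal.ofReal_mul (by positivity)]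
        congr 1
        rw [sqrt_two_div_pi, Real.sqrt_mul (by positivity)]
        field_simp
        ring

theorem exp_neg_le_quadratic {u : ℝ} (hu : 0 ≤ u) : Real.exp (-u) ≤ 1 - u + u ^ 2 / 2 := by
  have hmono : AntitoneOn (fun x : ℝ => Real.exp (-x) - (1 - x + x ^ 2 / 2)) (Set.Ici 0) := by
    have hd : ∀ x : ℝ, HasDerivAt (fun x : ℝ => Real.exp (-x) - (1 - x + x ^ 2 / 2))
        (-Real.exp (-x) - (-1 + x)) x := by
      intro x
      have h1 := (hasDerivAt_neg x).exp
      have h2 := ((hasDerivAt_id x).const_sub 1).add (((hasDerivAt_id x).pow 2).div_const 2)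
      convert! h1.sub h2 using 1
      simp
    refine antitoneOn_of_deriv_nonpos (convex_Ici 0)
      (fun x _ => (hd x).continuousAt.continuousWithinAt)
      (fun x _ => (hd x).differentiableAt.differentiableWithinAt) fun x _ => ?_
    rw [(hd x).deriv]
    linarith [Real.add_one_le_exp (-x)]
  have := hmono (Set.mem_Ici.2 le_rfl) (Set.mem_Ici.2 hu) hu
  simp at this
  linarith

/-- Source of the constant 2.35: the left side is about 0.4527 and the right side about 0.4533. The
slack is small, so the density is bounded through the second-order Taylor polynomial of the
exponential. -/
theorem gaussianReal_three_quarters_le_abs :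
    ENNReal.ofReal (√(2 / Real.pi) / (2.35 * (3 / 4))) ≤
      gaussianReal 0 1 {x : ℝ | 3 / 4 ≤ |x|} := by
  have hm : MeasurableSet {x : ℝ | 3 / 4 ≤ |x|} := measurableSet_le measurable_const measurable_id.abs
  have hc : {x : ℝ | 3 / 4 ≤ |x|}ᶜ ⊆ Set.Ioc (-(3 / 4)) (3 / 4) := by
    intro x hx
    simp only [Set.mem_compl_iff, Set.mem_ofPred_eq, not_le, abs_lt] at hx
    exact ⟨hx.1, hx.2.le⟩
  have hint : ∫ x in (-(3 / 4) : ℝ)..(3 / 4), gaussianPDFReal 0 1 x ≤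
      (√(2 * Real.pi))⁻¹ * (2 * 0.685621) := by
    calc ∫ x in (-(3 / 4) : ℝ)..(3 / 4), gaussianPDFReal 0 1 x
        ≤ ∫ x in (-(3 / 4) : ℝ)..(3 / 4),
            (√(2 * Real.pi))⁻¹ * (1 - x ^ 2 / 2 + x ^ 4 / 8) := by
          refine intervalIntegral.integral_mono_on (by norm_num)
            (integrable_gaussianPDFReal 0 1).intervalIntegrable
            (Continuous.intervalIntegrable (by fun_prop) _ _) fun x _ => ?_
          rw [gaussianPDFReal_def]
          have := exp_neg_le_quadratic (u := x ^ 2 / 2) (by positivity)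
          simp only [NNReal.coe_one, mul_one, sub_zero, neg_div]
          gcongr
          linarith
      _ = (√(2 * Real.pi))⁻¹ * (∫ x in (-(3 / 4) : ℝ)..(3 / 4), (1 - x ^ 2 / 2 + x ^ 4 / 8)) := by
          rw [intervalIntegral.integral_const_mul]
      _ ≤ _ := by
          gcongr
          rw [intervalIntegral.integral_add (Continuous.intervalIntegrable (by fun_prop) _ _)
            (Continuous.intervalIntegrable (by fun_prop) _ _),
            intervalIntegral.integral_sub (Continuous.intervalIntegrable (by fun_prop) _ _)
            (Continuous.intervalIntegrable (by fun_prop) _ _)]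
          simp only [intervalIntegral.integral_div, integral_pow, intervalIntegral.integral_const]
          norm_num
  have hreal : (gaussianReal 0 1).real {x : ℝ | 3 / 4 ≤ |x|}ᶜ ≤
      (√(2 * Real.pi))⁻¹ * (2 * 0.685621) := by
    refine le_trans (measureReal_mono hc) (le_trans (le_of_eq ?_) hint)
    rw [measureReal_def, gaussianReal_apply_eq_integral _ one_ne_zero, ENNReal.toReal_ofReal,
      intervalIntegral.integral_of_le (by norm_num)]
    exact integral_nonneg fun x => gaussianPDFReal_nonneg _ _ _
  -- The true value is about 0.39894; the final inequality tolerates up to about 0.39904.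
  have hk : (√(2 * Real.pi))⁻¹ ≤ 0.39899 := by
    rw [inv_le_comm₀ (by positivity) (by norm_num)]
    refine Real.le_sqrt_of_sq_le ?_
    have := Real.pi_gt_d4
    norm_num at this ⊢
    linarith
  rw [probReal_compl_eq_one_sub hm] at hreal
  rw [← ofReal_measureReal]
  refine ENNReal.ofReal_le_ofReal ?_
  rw [sqrt_two_div_pi, div_eq_mul_inv 2]
  norm_num at hreal hk ⊢
  linarith

end Gaussian

/-! ### The spectral norm and a maximizing direction. -/

section Matrices

theorem norm_toLp_mulVec_le {m n : ℕ} (A : Matrix (Fin m) (Fin n) ℝ) (x : Fin n → ℝ) :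
    ‖WithLp.toLp 2 (A *ᵥ x)‖ ≤ ‖A‖ * ‖WithLp.toLp 2 x‖ :=
  A.l2_opNorm_mulVec (WithLp.toLp 2 x)

/-- If the adjoint of `C` attains its norm at a unit vector `w`, take `u = Cᵀ w / ‖C‖`; then `‖C‖
⟨u, v⟩ = ⟨w, C v⟩`, and Cauchy–Schwarz applies. -/
theorem exists_norm_mul_abs_inner_le {n : ℕ} (hn : 1 ≤ n) (C : Matrix (Fin n) (Fin n) ℝ) :
    ∃ u : EuclideanSpace ℝ (Fin n), ‖u‖ = 1 ∧
      ∀ v : EuclideanSpace ℝ (Fin n), ‖C‖ * |inner ℝ u v| ≤ ‖WithLp.toLp 2 (C *ᵥ v.ofLp)‖ := by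
  have : Nonempty (Fin n) := ⟨⟨0, hn⟩⟩
  set T : EuclideanSpace ℝ (Fin n) →L[ℝ] EuclideanSpace ℝ (Fin n) := Matrix.toEuclideanCLM (𝕜 := ℝ) C
  have hTv : ∀ v, WithLp.toLp 2 (C *ᵥ v.ofLp) = T v := fun v => rfl
  have hT : ‖C‖ = ‖ContinuousLinearMap.adjoint T‖ := by
    rw [LinearIsometryEquiv.norm_map]
    rfl
  obtain ⟨w, hw, hmax⟩ := (isCompact_sphere (0 : EuclideanSpace ℝ (Fin n)) 1).exists_isMaxOn
    (NormedSpace.sphere_nonempty.2 zero_le_one)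
    (ContinuousLinearMap.adjoint T).continuous.norm.continuousOn
  have hw1 : ‖w‖ = 1 := by simpa using hw
  have hnorm : ‖ContinuousLinearMap.adjoint T w‖ = ‖C‖ := by
    rw [hT]
    refine le_antisymm (by simpa [hw1] using (ContinuousLinearMap.adjoint T).le_opNorm w) ?_
    refine ContinuousLinearMap.opNorm_le_of_unit_norm (norm_nonneg _) fun x hx => ?_
    exact hmax (by simpa using hx)
  have key : ∀ v, |inner ℝ (ContinuousLinearMap.adjoint T w) v| ≤ ‖T v‖ := by
    intro v
    rw [ContinuousLinearMap.adjoint_inner_left]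
    simpa [hw1] using abs_real_inner_le_norm w (T v)
  by_cases h0 : ‖C‖ = 0
  · exact ⟨w, hw1, fun v => by rw [h0, zero_mul]; exact norm_nonneg _⟩
  · refine ⟨‖C‖⁻¹ • ContinuousLinearMap.adjoint T w, ?_, fun v => ?_⟩
    · rw [norm_smul, hnorm, norm_inv, norm_norm, inv_mul_cancel₀ h0]
    · rw [real_inner_smul_left, abs_mul, abs_inv, abs_norm, ← mul_assoc, mul_inv_cancel₀ h0,
        one_mul, hTv]
      exact key v

end Matrices

/-! ### Almost sure invertibility, and the inverse applied to a fixed vector. -/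

section GaussianMatrix

variable {Ω : Type*} [MeasurableSpace Ω] {P : Measure Ω} [IsProbabilityMeasure P]
  {j m : ℕ} {G : Ω → Matrix (Fin j) (Fin m) ℝ} {μ σ : ℝ}

theorem IsGaussianMatrix.ae_det_mul_ne_zero (hσ : 0 < σ) (hG : IsGaussianMatrix G μ σ P)
    {N : Matrix (Fin m) (Fin j) ℝ} {L : Matrix (Fin j) (Fin m) ℝ} (hL : L * N = 1) :
    ∀ᵐ ω ∂P, (G ω * N).det ≠ 0 := by
  rcases Nat.eq_zero_or_pos j with rfl | hj
  · simp
  have : Nonempty (Fin j) := ⟨⟨0, hj⟩⟩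
  have hX : ∀ p : Fin j × Fin m, HasLaw (fun ω => G ω p.1 p.2)
    (gaussianReal μ (Real.toNNReal (σ ^ 2))) P := fun p => hG.hasLaw p.1 p.2
  set s : ℝ := ∑ p : Fin j × Fin m, L p.1 p.2 ^ 2 with hs
  have hs0 : 0 < s := by
    refine lt_of_le_of_ne (Finset.sum_nonneg fun _ _ => sq_nonneg _) fun h => ?_
    have hz := (Finset.sum_eq_zero_iff_of_nonneg (fun _ _ => sq_nonneg _)).1 h.symm
    have hL0 : L = 0 := by
      ext a b
      simpa using hz (a, b) (Finset.mem_univ _)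
    rw [hL0, Matrix.zero_mul] at hL
    exact zero_ne_one hL
  set r : ℝ := √s
  have hr : 0 < r := Real.sqrt_pos.2 hs0
  have hrs : r * r = s := Real.mul_self_sqrt hs0.le
  -- The unit vector along `L` for the Frobenius inner product, viewed as a one-row matrix.
  let u : Matrix Unit (Fin j × Fin m) ℝ := Matrix.of fun _ p => L p.1 p.2 / r
  have hu : u * uᵀ = 1 := by
    ext a b
    have : ∑ p : Fin j × Fin m, L p.1 p.2 / r * (L p.1 p.2 / r) = 1 := by
      simp_rw [div_mul_div_comm, ← Finset.sum_div, hrs, ← pow_two, ← hs, div_self hs0.ne']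
    simpa [Matrix.mul_apply, u, Matrix.one_apply] using this
  let B := fun ω => (fun p : Fin j × Fin m => G ω p.1 p.2) -
    uᵀ *ᵥ (u *ᵥ fun p : Fin j × Fin m => G ω p.1 p.2)
  let a := fun ω => u *ᵥ fun p : Fin j × Fin m => G ω p.1 p.2
  let A : (Fin j × Fin m → ℝ) → (Unit → ℝ) → Matrix (Fin j) (Fin j) ℝ := fun b c =>
    (Matrix.of fun i k => b (i, k)) * N + (c () / r) • 1
  have hT : ∀ (c : Unit → ℝ) i k, (uᵀ *ᵥ c) (i, k) = L i k / r * c () := by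
    intro c i k
    simp [Matrix.mulVec, dotProduct, u]
  have hA : ∀ ω, A (B ω) (a ω) = G ω * N := by
    intro ω
    have : (Matrix.of fun i k => B ω (i, k)) = G ω - (a ω () / r) • L := by
      ext i k
      change G ω i k - (uᵀ *ᵥ a ω) (i, k) = _
      rw [hT]
      simp only [Matrix.sub_apply, Matrix.smul_apply, smul_eq_mul]
      ring
    simp only [A]
    rw [this, Matrix.sub_mul, Matrix.smul_mul, hL]
    abel
  let S : Set ((Fin j × Fin m → ℝ) × (Unit → ℝ)) := {q | (A q.1 q.2).det = 0}
  have hS : MeasurableSet S := by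
    refine (isClosed_eq (Continuous.matrix_det ?_) continuous_const).measurableSet
    simp only [A]
    fun_prop
  have hnull : P {ω | (B ω, a ω) ∈ S} ≤ 0 := by
    refine measure_orthogonal_components_le hX hG.indep u hu hS fun b => ?_
    obtain ⟨c, hc⟩ := hasLaw_linComb_gaussianReal hX hG.indep (u ())
    have hv : Real.toNNReal (σ ^ 2) * Real.toNNReal (∑ i, u () i ^ 2) ≠ 0 := by
      have h1 : ∑ i, u () i ^ 2 = 1 := by
        have := congrFun (congrFun hu ()) ()
        simpa [Matrix.mul_apply, pow_two] using this
      rw [h1]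
      simp
      positivity
    set ν := gaussianReal c (Real.toNNReal (σ ^ 2) * Real.toNNReal (∑ i, u () i ^ 2))
    have := nullSingletonClass_gaussianReal (μ := c) hv
    have hfin : {y : ℝ | ((Matrix.of fun i k => b (i, k)) * N + (y / r) • 1 : Matrix _ _ ℝ).det = 0}.Finite := by
      -- The determinant is the characteristic polynomial of `Q` at `y / r`; being monic, it has
      -- finitely many roots.
      set Q := -((Matrix.of fun i k => b (i, k)) * N)
      refine ((Q.charpoly.rootSet_finite ℝ).preimage
        (f := fun y : ℝ => y / r) fun x _ y _ h => ?_).subset fun y hy => ?_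
      · exact (div_left_inj' hr.ne').1 h
      · rw [Set.mem_preimage, Polynomial.mem_rootSet]
        refine ⟨Q.charpoly_monic.ne_zero, ?_⟩
        rw [Polynomial.coe_aeval_eq_eval, Matrix.eval_charpoly, Matrix.scalar_apply,
          ← Matrix.smul_one_eq_diagonal, sub_neg_eq_add, add_comm]
        exact hy
    have hz := hfin.measure_zero ν
    rw [← hc.map_eq, Measure.map_apply_of_aemeasurable hc.aemeasurable hfin.measurableSet] at hz
    exact hz.le
  refine measure_mono_null (fun ω hω => ?_) (nonpos_iff_eq_zero.1 hnull)
  change (A (B ω) (a ω)).det = 0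
  rw [hA]
  exact not_not.1 hω

/-- On invertible matrices this is a tail bound for `‖(G N)⁻¹ v‖`. Clearing the determinant leaves
polynomials in the entries, so measurability follows from continuity. -/
theorem IsGaussianMatrix.measure_norm_adjugate_mulVec_le (hσ : 0 < σ)
    (hG : IsGaussianMatrix G μ σ P) {N : Matrix (Fin m) (Fin j) ℝ} {L : Matrix (Fin j) (Fin m) ℝ}
    (hL : L * N = 1) (v : EuclideanSpace ℝ (Fin j)) {x : ℝ} (hx : 0 < x) :
    P {ω | (G ω * N).det ≠ 0 ∧
        x * |(G ω * N).det| ≤ ‖WithLp.toLp 2 ((G ω * N).adjugate *ᵥ v.ofLp)‖} ≤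
      ENNReal.ofReal (√(2 / Real.pi) * ‖v‖ * ‖L‖ / (x * σ)) := by
  rcases eq_or_ne v 0 with rfl | hv
  · refine le_trans (measure_mono_null (fun ω hω => ?_) (measure_empty (μ := P))).le zero_le
    have h1 := abs_pos.2 hω.1
    have h2 := hω.2
    simp at h2
    nlinarith
  have hv0 : 0 < ‖v‖ := norm_pos_iff.2 hv
  have hX : ∀ p : Fin j × Fin m, HasLaw (fun ω => G ω p.1 p.2)
    (gaussianReal μ (Real.toNNReal (σ ^ 2))) P := fun p => hG.hasLaw p.1 p.2
  let e : Fin j → ℝ := fun i => v i / ‖v‖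
  have he : ∑ i, e i ^ 2 = 1 := by
    simp only [e, div_pow, ← Finset.sum_div]
    rw [← EuclideanSpace.real_norm_sq_eq, div_self (by positivity)]
  have hve : v.ofLp = ‖v‖ • e := by
    ext i
    simp [e]
    field_simp
  -- Applied to the entries of `G`, `u` gives the row vector `eᵀ G`.
  let u : Matrix (Fin m) (Fin j × Fin m) ℝ := Matrix.of fun k p => if k = p.2 then e p.1 else 0
  have hu : u * uᵀ = 1 := by
    ext k l
    simp only [Matrix.mul_apply, u, Matrix.transpose_apply, Matrix.of_apply, Fintype.sum_prod_type,
      mul_ite, ite_mul, zero_mul, mul_zero, Matrix.one_apply]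
    split_ifs with h
    · subst h
      simp [← pow_two, he]
    · simp [fun h' : k = l => h h']
  let B := fun ω => (fun p : Fin j × Fin m => G ω p.1 p.2) -
    uᵀ *ᵥ (u *ᵥ fun p : Fin j × Fin m => G ω p.1 p.2)
  let a := fun ω => u *ᵥ fun p : Fin j × Fin m => G ω p.1 p.2
  let A : (Fin j × Fin m → ℝ) → (Fin m → ℝ) → Matrix (Fin j) (Fin j) ℝ := fun b c =>
    (Matrix.of fun i k => b (i, k) + e i * c k) * N
  have hGB : ∀ ω, (Matrix.of fun i k => B ω (i, k) + e i * a ω k) = G ω := by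
    intro ω
    ext i k
    change G ω i k - (uᵀ *ᵥ a ω) (i, k) + e i * a ω k = G ω i k
    have hT : (uᵀ *ᵥ a ω) (i, k) = e i * a ω k := by
      simp [Matrix.mulVec, dotProduct, u]
    rw [hT, sub_add_cancel]
  have hA : ∀ ω, A (B ω) (a ω) = G ω * N := fun ω => by simp only [A, hGB]
  have hBdet : ∀ ω, ((Matrix.of fun i k => B ω (i, k)) * N).det = 0 := by
    intro ω
    refine Matrix.exists_vecMul_eq_zero_iff.1 ⟨e, fun h => by simp [h] at he, ?_⟩
    rw [← Matrix.vecMul_vecMul]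
    convert! Matrix.zero_vecMul N
    ext k
    have h1 : (Matrix.of fun i k => B ω (i, k)) = G ω - Matrix.vecMulVec e (a ω) := by
      rw [← hGB ω]
      ext i k
      simp [Matrix.vecMulVec_apply]
    have h2 : a ω k = (e ᵥ* G ω) k := by
      simp [a, u, Matrix.mulVec, Matrix.vecMul, dotProduct, Fintype.sum_prod_type]
    rw [h1, Matrix.vecMul_sub, Pi.sub_apply, ← h2, Matrix.vecMul_vecMulVec]
    simp [dotProduct, ← pow_two, he]
  -- Singularity of the frozen part is built into `S`: every nonempty section then comes with a
  -- kernel vector.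
  let S : Set ((Fin j × Fin m → ℝ) × (Fin m → ℝ)) :=
    {q | ((Matrix.of fun i k => q.1 (i, k)) * N).det = 0 ∧ (A q.1 q.2).det ≠ 0 ∧
      x * |(A q.1 q.2).det| ≤ ‖WithLp.toLp 2 ((A q.1 q.2).adjugate *ᵥ v.ofLp)‖}
  have hS : MeasurableSet S := by
    have hAc : Continuous fun q : (Fin j × Fin m → ℝ) × (Fin m → ℝ) => A q.1 q.2 := by
      simp only [A]
      fun_prop
    have h1 := hAc.matrix_det
    have h2 := hAc.matrix_adjugate
    refine (isClosed_eq (Continuous.matrix_det (by fun_prop)) continuous_const).measurableSet.inter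
      ((isClosed_eq h1 continuous_const).measurableSet.compl.inter
        (isClosed_le (continuous_const.mul h1.abs) ?_).measurableSet)
    exact ((PiLp.continuous_toLp 2 _).comp (h2.matrix_mulVec continuous_const)).norm
  have hsec : ∀ b, P {ω | (b, a ω) ∈ S} ≤
      ENNReal.ofReal (√(2 / Real.pi) * ‖v‖ * ‖L‖ / (x * σ)) := by
    intro b
    by_cases hb : ((Matrix.of fun i k => b (i, k)) * N).det = 0
    swap
    · refine le_trans (measure_mono_null (fun ω hω => ?_) (measure_empty (μ := P))).le zero_le
      exact hb hω.1
    obtain ⟨t, ht0, ht⟩ := Matrix.exists_mulVec_eq_zero_iff.2 hb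
    set w := N *ᵥ t with hw
    have htw : t = L *ᵥ w := by rw [hw, Matrix.mulVec_mulVec, hL, Matrix.one_mulVec]
    have htn : ‖WithLp.toLp 2 t‖ ≤ ‖L‖ * ‖WithLp.toLp 2 w‖ := by
      conv_lhs => rw [htw]
      exact norm_toLp_mulVec_le L w
    have hw0 : 0 < ‖WithLp.toLp 2 w‖ := by
      rw [norm_pos_iff]
      intro h
      have : w = 0 := by simpa using h
      rw [this, Matrix.mulVec_zero] at htw
      exact ht0 htw
    set ε := ‖v‖ * ‖WithLp.toLp 2 t‖ / x
    have hsub : ∀ c, (b, c) ∈ S → |∑ k, w k * c k| ≤ ε := by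
      rintro c ⟨-, hdet, hle⟩
      simp only at hdet hle
      set d := ∑ k, w k * c k with hd
      set y := (A b c).adjugate *ᵥ v.ofLp
      have hAy : A b c *ᵥ y = ((A b c).det * ‖v‖) • e := by
        rw [Matrix.mulVec_mulVec, Matrix.mul_adjugate, Matrix.smul_mulVec, Matrix.one_mulVec, hve,
          smul_smul]
      have hAt : A b c *ᵥ t = d • e := by
        have h1 : (Matrix.of fun i k => b (i, k) + e i * c k) =
            (Matrix.of fun i k => b (i, k)) + Matrix.vecMulVec e c := by
          ext i k
          simp [Matrix.vecMulVec_apply]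
        simp only [A]
        rw [h1, Matrix.add_mul, Matrix.add_mulVec, ht, zero_add, ← Matrix.mulVec_mulVec, ← hw,
          Matrix.vecMulVec_mulVec]
        ext i
        simp [dotProduct, hd, mul_comm]
      -- Both `y` and `t` are sent to multiples of `e`, so this combination lies in the trivial
      -- kernel of `A b c`.
      have hker : d • y - ((A b c).det * ‖v‖) • t = 0 := by
        by_contra hne
        refine hdet (Matrix.exists_mulVec_eq_zero_iff.1 ⟨_, hne, ?_⟩)
        rw [Matrix.mulVec_sub, Matrix.mulVec_smul, Matrix.mulVec_smul, hAy, hAt, smul_smul,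
          smul_smul, mul_comm, sub_self]
      have hn := congrArg (fun z => ‖WithLp.toLp 2 z‖) (sub_eq_zero.1 hker)
      simp only [WithLp.toLp_smul, norm_smul, Real.norm_eq_abs, abs_mul, abs_norm] at hn
      have hdp := abs_pos.2 hdet
      change |d| ≤ _
      rw [le_div_iff₀ hx]
      refine le_of_mul_le_mul_left ?_ hdp
      calc |(A b c).det| * (|d| * x) = |d| * (x * |(A b c).det|) := by ring
        _ ≤ |d| * ‖WithLp.toLp 2 y‖ := by gcongr
        _ = _ := by rw [hn]; ring
    have hlin : ∀ ω, ∑ k, w k * a ω k = ∑ p : Fin j × Fin m, (e p.1 * w p.2) * G ω p.1 p.2 := by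
      intro ω
      simp only [a, u, Matrix.mulVec, dotProduct, Fintype.sum_prod_type, Matrix.of_apply, ite_mul,
        zero_mul, Finset.sum_ite_eq, Finset.mem_univ, if_true, Finset.mul_sum]
      rw [Finset.sum_comm]
      exact Finset.sum_congr rfl fun _ _ => Finset.sum_congr rfl fun _ _ => by ring
    obtain ⟨c, hc⟩ := hasLaw_linComb_gaussianReal hX hG.indep (fun p => e p.1 * w p.2)
    have hvar : ((Real.toNNReal (σ ^ 2) * Real.toNNReal (∑ p : Fin j × Fin m, (e p.1 * w p.2) ^ 2) :
        NNReal) : ℝ) = (σ * ‖WithLp.toLp 2 w‖) ^ 2 := by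
      rw [NNReal.coe_mul, Real.coe_toNNReal _ (sq_nonneg σ),
        Real.coe_toNNReal _ (Finset.sum_nonneg fun _ _ => sq_nonneg _), mul_pow,
        EuclideanSpace.real_norm_sq_eq, Fintype.sum_prod_type]
      simp only [mul_pow, ← Finset.mul_sum, ← Finset.sum_mul, he, one_mul]
    have hmeas' : MeasurableSet {y : ℝ | |y| ≤ ε} :=
      (isClosed_le (by fun_prop) continuous_const).measurableSet
    calc P {ω | (b, a ω) ∈ S} ≤ P ((fun ω => ∑ p : Fin j × Fin m, (e p.1 * w p.2) * G ω p.1 p.2) ⁻¹' {y | |y| ≤ ε}) := by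
          refine measure_mono fun ω hω => ?_
          have h := hsub _ hω
          rw [hlin] at h
          exact h
      _ ≤ ENNReal.ofReal (√(2 / Real.pi) * ε / (σ * ‖WithLp.toLp 2 w‖)) := by
          rw [← Measure.map_apply_of_aemeasurable hc.aemeasurable hmeas', hc.map_eq]
          refine (gaussianReal_abs_le ?_ ε).trans_eq ?_
          · rw [← NNReal.coe_ne_zero, hvar]
            positivity
          · rw [hvar, Real.sqrt_sq (by positivity)]
      _ ≤ _ := by
          refine ENNReal.ofReal_le_ofReal ?_
          simp only [ε]
          rw [div_le_div_iff₀ (by positivity) (by positivity)]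
          have h3 : √(2 / Real.pi) * (‖v‖ * ‖WithLp.toLp 2 t‖ / x) * (x * σ) =
            √(2 / Real.pi) * ‖v‖ * σ * ‖WithLp.toLp 2 t‖ := by field_simp
          rw [h3]
          calc _ ≤ √(2 / Real.pi) * ‖v‖ * σ * (‖L‖ * ‖WithLp.toLp 2 w‖) := by gcongr
            _ = _ := by ring
  refine le_trans (measure_mono fun ω hω => ?_)
    (measure_orthogonal_components_le hX hG.indep u hu hS hsec)
  change (B ω, a ω) ∈ S
  simpa [S, hBdet, hA] using hω

end GaussianMatrix

/-! ### The auxiliary standard Gaussian vector. -/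

section StdGaussian

/-- Nonnegativity of the variance of `‖v‖` gives `(E‖v‖)² ≤ E‖v‖²`, which equals `n`. -/
theorem integral_norm_stdGaussian_le (n : ℕ) :
    ∫ v, ‖v‖ ∂(stdGaussian (EuclideanSpace ℝ (Fin n))) ≤ √n := by
  set γ := stdGaussian (EuclideanSpace ℝ (Fin n))
  have hL : MemLp (fun v : EuclideanSpace ℝ (Fin n) => v) 2 γ := IsGaussian.memLp_two_id
  have hcoord : ∀ i, Integrable (fun v : EuclideanSpace ℝ (Fin n) => v i ^ 2) γ ∧
      ∫ v, v i ^ 2 ∂γ = 1 := by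
    intro i
    set T : StrongDual ℝ (EuclideanSpace ℝ (Fin n)) := EuclideanSpace.proj i
    have hT : MemLp T 2 γ := T.comp_memLp' hL
    have hn : ‖T‖ = 1 := by
      have : T = innerSL ℝ (EuclideanSpace.single i (1 : ℝ)) := by
        ext v
        simp [T, EuclideanSpace.inner_single_left]
      rw [this, innerSL_apply_norm]
      simp
    have hv := variance_dual_stdGaussian (E := EuclideanSpace ℝ (Fin n)) T
    rw [hn, one_pow, variance_of_integral_eq_zero hT.aemeasurable
      (integral_strongDual_stdGaussian T)] at hv
    exact ⟨hT.integrable_sq, hv⟩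
  have hsq : ∫ v, ‖v‖ ^ 2 ∂γ = n := by
    simp_rw [EuclideanSpace.real_norm_sq_eq]
    rw [integral_finsetSum _ fun i _ => (hcoord i).1]
    simp [fun i => (hcoord i).2]
  have hvar := variance_nonneg (fun v : EuclideanSpace ℝ (Fin n) => ‖v‖) γ
  rw [variance_eq_sub hL.norm] at hvar
  refine Real.le_sqrt_of_sq_le ?_
  simp only [Pi.pow_apply] at hvar
  linarith

theorem stdGaussian_inner_ge {n : ℕ} {u : EuclideanSpace ℝ (Fin n)} (hu : ‖u‖ = 1) :
    ENNReal.ofReal (√(2 / Real.pi) / (2.35 * (3 / 4))) ≤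
      stdGaussian (EuclideanSpace ℝ (Fin n)) {v | 3 / 4 ≤ |inner ℝ u v|} := by
  have hm : MeasurableSet {x : ℝ | 3 / 4 ≤ |x|} := measurableSet_le measurable_const measurable_id.abs
  have hmap : (stdGaussian (EuclideanSpace ℝ (Fin n))).map (innerSL ℝ u) = gaussianReal 0 1 := by
    rw [IsGaussian.map_eq_gaussianReal, integral_strongDual_stdGaussian,
      variance_dual_stdGaussian, innerSL_apply_norm, hu]
    simp
  have h := gaussianReal_three_quarters_le_abs
  rwa [← hmap, Measure.map_apply (innerSL ℝ u).continuous.measurable hm] at h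

end StdGaussian

/-! ### From fixed vectors to the spectral norm. -/

section GaussianMatrix

variable {Ω : Type*} [MeasurableSpace Ω] {P : Measure Ω} [IsProbabilityMeasure P]
  {j m : ℕ} {G : Ω → Matrix (Fin j) (Fin m) ℝ} {μ σ : ℝ}

/-- The event `T` for an independent Gaussian `v` is measured in both orders of integration. With
`G` fixed in `S`, it contains `3/4 ≤ |⟨u, v⟩|`; with `v` fixed, the vector bound applies at level
`3z/4`. The factors `√(2/π)` and `3/4` cancel. -/
theorem IsGaussianMatrix.measure_norm_adjugate_le (hj : 1 ≤ j) (hσ : 0 < σ)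
    (hG : IsGaussianMatrix G μ σ P) {N : Matrix (Fin m) (Fin j) ℝ} {L : Matrix (Fin j) (Fin m) ℝ}
    (hL : L * N = 1) {z : ℝ} (hz : 0 < z) :
    P {ω | (G ω * N).det ≠ 0 ∧ z * |(G ω * N).det| ≤ ‖(G ω * N).adjugate‖} ≤
      ENNReal.ofReal (2.35 * √j * ‖L‖ / (z * σ)) := by
  set γ := stdGaussian (EuclideanSpace ℝ (Fin j))
  set X : Ω → Fin j × Fin m → ℝ := fun ω p => G ω p.1 p.2
  have hX : AEMeasurable X P :=
    (hG.indep.hasGaussianLaw fun p : Fin j × Fin m => (hG.hasLaw p.1 p.2).hasGaussianLaw).aemeasurable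
  have : IsProbabilityMeasure (P.map X) := Measure.isProbabilityMeasure_map hX
  let A : (Fin j × Fin m → ℝ) → Matrix (Fin j) (Fin j) ℝ := fun g =>
    (Matrix.of fun i k => g (i, k)) * N
  have hAX : ∀ ω, A (X ω) = G ω * N := fun ω => rfl
  have hAc : Continuous A := by
    simp only [A]
    fun_prop
  have hdet : Continuous fun g => (A g).det := hAc.matrix_det
  have hadj : Continuous fun g => (A g).adjugate := hAc.matrix_adjugate
  let S : Set (Fin j × Fin m → ℝ) := {g | (A g).det ≠ 0 ∧ z * |(A g).det| ≤ ‖(A g).adjugate‖}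
  have hS : MeasurableSet S :=
    (isClosed_eq hdet continuous_const).measurableSet.compl.inter
      (isClosed_le (continuous_const.mul hdet.abs) hadj.norm).measurableSet
  let T : Set ((Fin j × Fin m → ℝ) × EuclideanSpace ℝ (Fin j)) :=
    {q | (A q.1).det ≠ 0 ∧
      z * (3 / 4) * |(A q.1).det| ≤ ‖WithLp.toLp 2 ((A q.1).adjugate *ᵥ q.2.ofLp)‖}
  have hT : MeasurableSet T := by
    refine (isClosed_eq (hdet.comp continuous_fst) continuous_const).measurableSet.compl.inter
      (isClosed_le (continuous_const.mul (hdet.comp continuous_fst).abs) ?_).measurableSet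
    exact ((PiLp.continuous_toLp 2 _).comp ((hadj.comp continuous_fst).matrix_mulVec
      ((PiLp.continuous_ofLp 2 _).comp continuous_snd))).norm
  have hlow : ENNReal.ofReal (√(2 / Real.pi) / (2.35 * (3 / 4))) * P.map X S ≤
      ((P.map X).prod γ) T := by
    rw [Measure.prod_apply hT, ← setLIntegral_const]
    refine le_trans (setLIntegral_mono' hS fun g hg => ?_) (setLIntegral_le_lintegral S _)
    obtain ⟨u, hu, hC⟩ := exists_norm_mul_abs_inner_le hj (A g).adjugate
    refine (stdGaussian_inner_ge hu).trans (measure_mono fun v hv => ⟨hg.1, ?_⟩)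
    calc z * (3 / 4) * |(A g).det| = (z * |(A g).det|) * (3 / 4) := by ring
      _ ≤ ‖(A g).adjugate‖ * |inner ℝ u v| := mul_le_mul hg.2 hv (by norm_num) (norm_nonneg _)
      _ ≤ _ := hC v
  have hup : ((P.map X).prod γ) T ≤
      ENNReal.ofReal (√(2 / Real.pi) * ‖L‖ / (z * (3 / 4) * σ) * √j) := by
    rw [Measure.prod_apply_symm hT]
    calc ∫⁻ v, (P.map X) ((fun g => (g, v)) ⁻¹' T) ∂γ
        ≤ ∫⁻ v, ENNReal.ofReal (√(2 / Real.pi) * ‖L‖ / (z * (3 / 4) * σ) * ‖v‖) ∂γ := by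
          refine lintegral_mono fun v => ?_
          rw [Measure.map_apply_of_aemeasurable hX (measurable_prodMk_right hT)]
          refine (hG.measure_norm_adjugate_mulVec_le hσ hL v (x := z * (3 / 4))
            (by positivity)).trans_eq ?_
          congr 1
          ring
      _ = ENNReal.ofReal (∫ v, √(2 / Real.pi) * ‖L‖ / (z * (3 / 4) * σ) * ‖v‖ ∂γ) := by
          rw [ofReal_integral_eq_lintegral_ofReal]
          · exact (IsGaussian.integrable_id (μ := γ)).norm.const_mul _
          · exact Filter.Eventually.of_forall fun v => by positivity
      _ ≤ _ := by
          rw [integral_const_mul]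
          refine ENNReal.ofReal_le_ofReal ?_
          gcongr
          exact integral_norm_stdGaussian_le j
  have hPS : P {ω | (G ω * N).det ≠ 0 ∧ z * |(G ω * N).det| ≤ ‖(G ω * N).adjugate‖} =
      P.map X S := by
    rw [Measure.map_apply_of_aemeasurable hX hS]
    rfl
  rw [hPS]
  have hc : 0 < √(2 / Real.pi) / (2.35 * (3 / 4)) := by positivity
  refine (ENNReal.mul_le_mul_iff_right (ENNReal.ofReal_pos.2 hc).ne' ENNReal.ofReal_ne_top).1
    ((hlow.trans hup).trans_eq ?_)
  rw [← ENNReal.ofReal_mul hc.le]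
  congr 1
  field_simp

end GaussianMatrix

/-! ### Pseudo-inverses and rank. -/

section Pinv

theorem pinv_mul_self_of_injective {m n : ℕ} {N : Matrix (Fin m) (Fin n) ℝ}
    (hN : Function.Injective N.mulVec) : pinv N * N = 1 := by
  refine Matrix.ext_of_mulVec_single fun i => hN ?_
  rw [Matrix.mulVec_mulVec, Matrix.mulVec_mulVec, ← Matrix.mul_assoc,
    (pinv_isMoorePenrose N).mul_mul_left, Matrix.mul_one]

theorem mulVec_injective_of_rank_eq {m n : ℕ} {N : Matrix (Fin m) (Fin n) ℝ} (hN : N.rank = n) :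
    Function.Injective N.mulVec := by
  rw [Matrix.mulVec_injective_iff, linearIndependent_iff_card_eq_finrank_span,
    Set.finrank, ← Matrix.rank_eq_finrank_span_cols, hN, Fintype.card_fin]

theorem pinv_eq_inv {n : ℕ} {A : Matrix (Fin n) (Fin n) ℝ} (hA : A.det ≠ 0) : pinv A = A⁻¹ := by
  have hu : IsUnit A.det := hA.isUnit
  refine (pinv_isMoorePenrose A).unique ⟨?_, ?_, ?_, ?_⟩
  · rw [Matrix.mul_nonsing_inv _ hu, Matrix.one_mul]
  · rw [Matrix.nonsing_inv_mul _ hu, Matrix.one_mul]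
  · rw [Matrix.mul_nonsing_inv _ hu, Matrix.transpose_one]
  · rw [Matrix.nonsing_inv_mul _ hu, Matrix.transpose_one]

theorem pinv_transpose {m n : ℕ} (A : Matrix (Fin m) (Fin n) ℝ) : pinv Aᵀ = (pinv A)ᵀ := by
  have h := pinv_isMoorePenrose A
  refine (pinv_isMoorePenrose Aᵀ).unique ⟨?_, ?_, ?_, ?_⟩
  · rw [← Matrix.transpose_mul, ← Matrix.transpose_mul, ← Matrix.mul_assoc, h.mul_mul_left]
  · rw [← Matrix.transpose_mul, ← Matrix.transpose_mul, ← Matrix.mul_assoc, h.mul_mul_right]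
  · rw [← Matrix.transpose_mul, h.symm_right, h.symm_right]
  · rw [← Matrix.transpose_mul, h.symm_left, h.symm_left]

theorem norm_pinv_transpose {m n : ℕ} (A : Matrix (Fin m) (Fin n) ℝ) :
    ‖pinv Aᵀ‖ = ‖pinv A‖ := by
  rw [pinv_transpose, ← Matrix.conjTranspose_eq_transpose_of_trivial,
    Matrix.l2_opNorm_conjTranspose]

theorem norm_adjugate_eq_of_det_ne_zero {n : ℕ} {A : Matrix (Fin n) (Fin n) ℝ} (hA : A.det ≠ 0) :
    ‖A.adjugate‖ = ‖pinv A‖ * |A.det| := by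
  rw [pinv_eq_inv hA, Matrix.inv_def, Ring.inverse_eq_inv', norm_smul, norm_inv, Real.norm_eq_abs]
  field_simp

theorem exists_mul_injective_of_le_rank {m n q : ℕ} {M : Matrix (Fin m) (Fin n) ℝ}
    (hq : q ≤ M.rank) :
    ∃ W : Matrix (Fin n) (Fin q) ℝ, Function.Injective (M * W).mulVec := by
  obtain ⟨f, hf⟩ := exists_linearIndependent_of_le_finrank (R := ℝ)
    (M := LinearMap.range M.mulVecLin) hq
  choose w hw using fun i => (f i).2
  refine ⟨(Matrix.of w)ᵀ, ?_⟩
  rw [Matrix.mulVec_injective_iff]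
  convert! hf.map' (LinearMap.range M.mulVecLin).subtype (Submodule.ker_subtype _) using 1
  ext i k
  exact congrFun (hw i) k

end Pinv

/-! ### Rank and tail bounds for Gaussian products. -/

section GaussianMatrix

variable {Ω : Type*} [MeasurableSpace Ω] {P : Measure Ω} {q m : ℕ}
  {G : Ω → Matrix (Fin q) (Fin m) ℝ} {μ σ : ℝ}

theorem IsGaussianMatrix.transpose (hG : IsGaussianMatrix G μ σ P) :
    IsGaussianMatrix (fun ω => (G ω)ᵀ) μ σ P where
  hasLaw i j := hG.hasLaw j i
  indep := hG.indep.precomp (g := Prod.swap) Prod.swap_injective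

theorem IsGaussianMatrix.leadingRows (hG : IsGaussianMatrix G μ σ P) {j : ℕ} (hj : j ≤ q) :
    IsGaussianMatrix (fun ω => leadingRows (G ω) j hj) μ σ P where
  hasLaw _ k := hG.hasLaw _ k
  indep := hG.indep.precomp (g := Prod.map (Fin.castLE hj) id)
    ((Fin.castLE_injective hj).prodMap Function.injective_id)

variable [IsProbabilityMeasure P]

theorem IsGaussianMatrix.ae_rank_mul (hσ : 0 < σ) (hG : IsGaussianMatrix G μ σ P) {n : ℕ}
    {M : Matrix (Fin m) (Fin n) ℝ} (hq : q ≤ M.rank) : ∀ᵐ ω ∂P, (G ω * M).rank = min q n := by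
  obtain ⟨W, hW⟩ := exists_mul_injective_of_le_rank hq
  filter_upwards [hG.ae_det_mul_ne_zero hσ (pinv_mul_self_of_injective hW)] with ω hω
  rw [min_eq_left (hq.trans M.rank_le_width)]
  refine le_antisymm (Matrix.rank_le_height _) ?_
  have h := Matrix.rank_of_det_ne_zero hω
  rw [Fintype.card_fin, ← Matrix.mul_assoc] at h
  exact h.symm.le.trans (Matrix.rank_mul_le_left _ _)

theorem IsGaussianMatrix.measureReal_le_norm_pinv_mul (hq : 1 ≤ q) (hσ : 0 < σ)
    (hG : IsGaussianMatrix G μ σ P) {N : Matrix (Fin m) (Fin q) ℝ} (hN : N.rank = q)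
    {z : ℝ} (hz : 0 < z) :
    P.real {ω | z ≤ ‖pinv (G ω * N)‖} ≤ 2.35 * √q * ‖pinv N‖ / (z * σ) := by
  have hL := pinv_mul_self_of_injective (mulVec_injective_of_rank_eq hN)
  refine ENNReal.toReal_le_of_le_ofReal (by positivity)
    (le_trans (measure_mono_ae ?_) (hG.measure_norm_adjugate_le hq hσ hL hz))
  filter_upwards [hG.ae_det_mul_ne_zero hσ hL] with ω hω h
  refine ⟨hω, ?_⟩
  rw [norm_adjugate_eq_of_det_ne_zero hω]
  exact mul_le_mul_of_nonneg_right h (abs_nonneg _)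

theorem IsGaussianMatrix.cdfOf_and_tail_pinv_mul (hq : 1 ≤ q) (hσ : 0 < σ)
    (hG : IsGaussianMatrix G μ σ P) {N : Matrix (Fin m) (Fin q) ℝ} (hN : N.rank = q) :
    (∀ y : ℝ, 0 ≤ y → cdfOf P (fun ω => 1 / ‖pinv (G ω * N)‖) y
        ≤ 2.35 * y * √(q : ℝ) * ‖pinv N‖ / σ) ∧
      (∀ x : ℝ, 0 < x →
        P.real {ω | 2.35 * x * √(q : ℝ) * ‖pinv N‖ / σ ≤ ‖pinv (G ω * N)‖} ≤ 1 / x) := by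
  have hL := pinv_mul_self_of_injective (mulVec_injective_of_rank_eq hN)
  have : Nonempty (Fin q) := ⟨⟨0, hq⟩⟩
  have hpos : ∀ᵐ ω ∂P, 0 < ‖pinv (G ω * N)‖ := by
    filter_upwards [hG.ae_det_mul_ne_zero hσ hL] with ω hω
    rw [norm_pos_iff]
    intro h
    have h1 := (pinv_isMoorePenrose (G ω * N)).mul_mul_left
    rw [h, Matrix.mul_zero, Matrix.zero_mul] at h1
    exact hω (by rw [← h1, Matrix.det_zero])
  have hN0 : 0 < ‖pinv N‖ := by
    rw [norm_pos_iff]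
    intro h
    rw [h, Matrix.zero_mul] at hL
    exact zero_ne_one hL
  have hq0 : (0 : ℝ) < q := by exact_mod_cast hq
  refine ⟨fun y hy => ?_, fun x hx => ?_⟩
  -- At `y = 0` the level `1 / y` is unusable; the event is null because the pseudo-inverse is
  -- almost surely nonzero.
  · rcases hy.eq_or_lt with rfl | hy
    · refine le_trans (le_of_eq ?_) (by simp : (0 : ℝ) ≤ _)
      rw [cdfOf, measureReal_eq_zero_iff]
      refine measure_mono_null (fun ω hω => ?_) hpos
      intro h
      exact (not_lt.2 (Set.mem_ofPred_eq ▸ hω)) (one_div_pos.2 h)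
    · have h := hG.measureReal_le_norm_pinv_mul hq hσ hN (z := 1 / y) (by positivity)
      refine le_trans (ENNReal.toReal_mono (measure_ne_top _ _) (measure_mono_ae ?_))
        (h.trans_eq (by field_simp))
      filter_upwards [hpos] with ω hω h
      exact (one_div_le hω hy).1 h
  · refine (hG.measureReal_le_norm_pinv_mul hq hσ hN (by positivity)).trans_eq ?_
    field_simp

end GaussianMatrix

theorem leadingBlock_mul {q m n j : ℕ} (A : Matrix (Fin q) (Fin m) ℝ)
    (B : Matrix (Fin m) (Fin n) ℝ) (hq : j ≤ q) (hn : j ≤ n) :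
    leadingBlock (A * B) j hq hn = leadingRows A j hq * leadingCols B j hn := rfl

theorem mainTheorem2 {Ω : Type*} [MeasurableSpace Ω] (P : Measure Ω) [IsProbabilityMeasure P]
    (m n q s : ℕ) (M : Matrix (Fin m) (Fin n) ℝ) (μ σ : ℝ) (hσ : 0 < σ)
    (G : Ω → Matrix (Fin q) (Fin m) ℝ) (hG : IsGaussianMatrix G μ σ P)
    (H : Ω → Matrix (Fin n) (Fin s) ℝ) (hH : IsGaussianMatrix H μ σ P) :
    -- (i)
    (q ≤ M.rank → ∀ᵐ ω ∂P, (G ω * M).rank = min q n) ∧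
    (s ≤ M.rank → ∀ᵐ ω ∂P, (M * H ω).rank = min m s) ∧
    -- (ii) for the leading blocks of `G M`
    (∀ (j : ℕ) (_ : 1 ≤ j) (hjq : j ≤ q) (hjn : j ≤ n), (leadingCols M j hjn).rank = j →
      (∀ y : ℝ, 0 ≤ y →
        cdfOf P (fun ω => 1 / ‖pinv (leadingBlock (G ω * M) j hjq hjn)‖) y
          ≤ 2.35 * y * √(j : ℝ) * ‖pinv (leadingCols M j hjn)‖ / σ) ∧
      (∀ x : ℝ, 0 < x →
        P.real {ω | 2.35 * x * √(j : ℝ) * ‖pinv (leadingCols M j hjn)‖ / σ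
            ≤ ‖pinv (leadingBlock (G ω * M) j hjq hjn)‖} ≤ 1 / x)) ∧
    -- (ii) for the leading blocks of `M H`
    (∀ (k : ℕ) (_ : 1 ≤ k) (hkm : k ≤ m) (hks : k ≤ s), (leadingRows M k hkm).rank = k →
      (∀ y : ℝ, 0 ≤ y →
        cdfOf P (fun ω => 1 / ‖pinv (leadingBlock (M * H ω) k hkm hks)‖) y
          ≤ 2.35 * y * √(k : ℝ) * ‖pinv (leadingRows M k hkm)‖ / σ) ∧
      (∀ x : ℝ, 0 < x →
        P.real {ω | 2.35 * x * √(k : ℝ) * ‖pinv (leadingRows M k hkm)‖ / σ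
            ≤ ‖pinv (leadingBlock (M * H ω) k hkm hks)‖} ≤ 1 / x)) := by
  refine ⟨fun h => hG.ae_rank_mul hσ h, fun h => ?_, fun j hj hjq hjn hr => ?_,
    fun k hk hkm hks hr => ?_⟩
  · rw [← Matrix.rank_transpose] at h
    filter_upwards [hH.transpose.ae_rank_mul hσ h] with ω hω
    rw [← Matrix.rank_transpose, Matrix.transpose_mul, hω, min_comm]
  · simp only [leadingBlock_mul]
    exact (hG.leadingRows hjq).cdfOf_and_tail_pinv_mul hj hσ hr
  · have hcol : leadingCols Mᵀ k hkm = (leadingRows M k hkm)ᵀ := rfl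
    have hblock : ∀ ω, leadingBlock (M * H ω) k hkm hks =
        (leadingRows (H ω)ᵀ k hks * leadingCols Mᵀ k hkm)ᵀ := by
      intro ω
      rw [← leadingBlock_mul, ← Matrix.transpose_mul]
      rfl
    have h := (hH.transpose.leadingRows hks).cdfOf_and_tail_pinv_mul hk hσ
      (N := leadingCols Mᵀ k hkm) (by rw [hcol, Matrix.rank_transpose, hr])
    simp only [hblock, norm_pinv_transpose]
    rw [hcol, norm_pinv_transpose] at h
    exact h
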